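/- Let $k\ge 2$ and let $\tau = 1\,2\cdots k\in S_k$ be the increasing permutation. A permutation $\sigma=\sigma_1\cdots\sigma_n\in S_n$ has a $\tau$-match if for some $1\le i\le n-k+1$ the consecutive block $\sigma_i\sigma_{i+1}\cdots\sigma_{i+k-1}$ reduces to $\tau$, where the reduction of a word with distinct letters is obtained by replacing its $r$-th smallest letter by $r$ for every $r$. A letter $\sigma_j$ is a left-to-right minimum of $\sigma$ if $\sigma_j<\sigma_i$ for all $i<j$; let $\mathrm{LRmin}(\sigma)$ be the number of left-to-right minima of $\sigma$. Let $\mathcal{NMS}_n(\tau)$ be the set of $\sigma\in S_n$ that have no $\tau$-matches (for $n=0$ this consists of the empty permutation, with $\mathrm{LRmin}=0$), and put $$NM_\tau(t,x)=\sum_{n\ge 0}\frac{t^n}{n!}\sum_{\sigma\in\mathcal{NMS}_n(\tau)}x^{\mathrm{LRmin}(\sigma)},$$ a formal power series in $t$ with coefficients in $\mathbb{Q}[x]$. Then $$NM_{\tau}(t,x)=\left(\frac{1}{\sum_{i\ge 0}\left(\frac{t^{ki}}{(ki)!}-\frac{t^{ki+1}}{(ki+1)!}\right)}\right)^{x},$$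 where, for a formal power series $F$ in $t$ over $\mathbb{Q}$ with constant term $1$, $F^x$ denotes $\exp(x\log F)\in\mathbb{Q}[x][[t]]$. -/

import Mathlib

namespace PermMatch

/-- The reduction `red(w)` of a word `w` with distinct letters: the `i`-th smallest letter
is replaced by `i`. Ranks are counted from `0`, in accordance with the representation of
permutations of `{1, …, n}` by permutations of `Fin n`. -/
def red {j n : ℕ} (w : Fin j → Fin n) (a : Fin j) : ℕ :=
  (Finset.univ.filter fun b : Fin j => w b < w a).card

/-- The permutation `σ`, read as the word `σ 0, σ 1, …, σ (n - 1)`, has a `τ`-match: some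
block of `j` consecutive letters of `σ` reduces to `τ`. -/
def HasMatch {j n : ℕ} (τ : Equiv.Perm (Fin j)) (σ : Equiv.Perm (Fin n)) : Prop :=
  ∃ (s : ℕ) (h : s + j ≤ n), ∀ a : Fin j,
    red (fun b : Fin j => σ ⟨s + b, lt_of_lt_of_le (Nat.add_lt_add_left b.isLt s) h⟩) a = τ a

/-- The set of permutations in `S_n` without `τ`-matches. -/
noncomputable def noMatch {j : ℕ} (τ : Equiv.Perm (Fin j)) (n : ℕ) :
    Finset (Equiv.Perm (Fin n)) :=
  open Classical in Finset.univ.filter fun σ => ¬ HasMatch τ σ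

/-- The number of left-to-right minima of `σ`: the positions `b` such that `σ b < σ a` for
all earlier positions `a`. -/
def lrMin {n : ℕ} (σ : Equiv.Perm (Fin n)) : ℕ :=
  (Finset.univ.filter fun b : Fin n => ∀ a : Fin n, a < b → σ b < σ a).card

/-- The generating function `NM_τ(t, x)`, as a formal power series in `t` whose coefficients
are polynomials in `x`. -/
noncomputable def NM {j : ℕ} (τ : Equiv.Perm (Fin j)) : PowerSeries (Polynomial ℚ) :=
  PowerSeries.mk fun n =>
    Polynomial.C (1 / (n.factorial : ℚ)) *
      ∑ σ ∈ noMatch τ n, (Polynomial.X : Polynomial ℚ) ^ lrMin σ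

/-- The term `t^{ki} / (ki)! - t^{ki+1} / (ki+1)!`. -/
noncomputable def summand (k i : ℕ) : PowerSeries ℚ :=
  PowerSeries.monomial (k * i) (1 / ((k * i).factorial : ℚ)) -
    PowerSeries.monomial (k * i + 1) (1 / ((k * i + 1).factorial : ℚ))

/-- The formal sum of `summand k i` over all `i ≥ 0`. For `k ≥ 1` the terms with `i > n` have no
coefficient at `t^n`, so that each coefficient of the sum is a finite sum. -/
noncomputable def denom (k : ℕ) : PowerSeries ℚ :=
  PowerSeries.mk fun n => ∑ i ∈ Finset.range (n + 1), PowerSeries.coeff n (summand k i)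

/-- The formal power `f ^ a = exp (a * log f)` of a power series `f` with constant coefficient
`1`, the exponent being an element of the coefficient ring. -/
noncomputable def formalPow {A : Type*} [CommRing A] [Algebra ℚ A] (f : PowerSeries A) (a : A) :
    PowerSeries A :=
  (PowerSeries.exp A).subst (PowerSeries.C a * PowerSeries.logOf f)

end PermMatch

/-! Cut a nonempty permutation at its smallest letter. No match straddles the cut, since the letter
before the minimum is larger. The left factor is match-free and contributes its left-to-right minima
plus one; the right factor must stay match-free with a smaller letter put in front. As the relative
orders of the two factors are independent, `NM` satisfies the equation `N' = x C N` with `C` free of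
`x` (`derivative_NM`). At `x = 1` this reads `R' = C R` for the series `R` of match-free
permutations, so `N` and `R ^ x` solve the same linear equation with the same constant term
(`eq_formalPow`).

It remains to see that `R` is the reciprocal of `denom` (`runFreeSeries_mul_denom`). Each
coefficient of the product counts, with sign, the ways to cut a permutation into a match-free prefix
and an increasing suffix. For a nonempty permutation the signs cancel (`sum_cut_eq_zero`). -/

namespace PermMatch

/-! ### Formal powers via linear differential equations -/

section FormalPow

open PowerSeries

theorem derivative_logOf_mul {A : Type*} [CommRing A] [Algebra ℚ A] {f : PowerSeries A}
    (hf : constantCoeff f = 1) : derivative A (logOf f) * f = derivative A f := by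
  have hs : HasSubst (f - 1) := HasSubst.of_constantCoeff_zero' (by simp [hf])
  have hgeom : derivative A (log A) * (1 + X) = 1 := by
    rw [deriv_log]
    ext n
    rw [mul_add, mul_one, map_add]
    cases n with
    | zero => simp
    | succ n => simp [coeff_succ_mul_X, pow_succ, coeff_one]
  have h := congrArg (PowerSeries.subst (f - 1)) hgeom
  have h1 : PowerSeries.subst (f - 1) (1 : PowerSeries A) = 1 := by
    rw [← coe_substAlgHom hs, map_one]
  rw [subst_mul hs, subst_add hs, subst_X hs, h1, add_sub_cancel] at h
  rw [logOf_eq, derivative_subst hs, mul_right_comm, h, one_mul, map_sub, derivative_one, sub_zero]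

/-- The equation determines the coefficient at `n + 1` from those up to `n`, because `n + 1` can be
cancelled. -/
theorem eq_of_derivative_eq_mul {A : Type*} [CommRing A] [IsDomain A] [CharZero A]
    {f g u : PowerSeries A} (hf : derivative A f = u * f) (hg : derivative A g = u * g)
    (h0 : constantCoeff f = constantCoeff g) : f = g := by
  ext n
  induction n using Nat.strong_induction_on with
  | _ n ih =>
    cases n with
    | zero => simpa using h0
    | succ n =>
      have h : coeff n (derivative A f) = coeff n (derivative A g) := by
        rw [hf, hg, coeff_mul, coeff_mul]
        refine Finset.sum_congr rfl fun x hx => ?_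
        rw [ih x.2 (by have := Finset.HasAntidiagonal.mem_antidiagonal.1 hx; omega)]
      rw [coeff_derivative, coeff_derivative] at h
      exact mul_right_cancel₀ (by exact_mod_cast n.succ_ne_zero) h

theorem constantCoeff_formalPow {A : Type*} [CommRing A] [Algebra ℚ A] {f : PowerSeries A}
    (hf : constantCoeff f = 1) (a : A) : constantCoeff (formalPow f a) = 1 := by
  have h0 : constantCoeff (C a * logOf f) = 0 := by rw [map_mul, constantCoeff_logOf hf, mul_zero]
  have hs : HasSubst (C a * logOf f) := HasSubst.of_constantCoeff_zero' h0
  have h : exp A = (exp A - 1) + 1 := by ring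
  have h1 : PowerSeries.subst (C a * logOf f) (1 : PowerSeries A) = 1 := by
    rw [← coe_substAlgHom hs, map_one]
  rw [formalPow, h, subst_add hs, h1, map_add, map_one, add_eq_right]
  exact constantCoeff_subst_eq_zero h0 _ (by simp)

theorem derivative_formalPow {A : Type*} [CommRing A] [Algebra ℚ A] {f : PowerSeries A}
    (hf : constantCoeff f = 1) (a : A) :
    derivative A (formalPow f a) = C a * derivative A (logOf f) * formalPow f a := by
  have hs : HasSubst (C a * logOf f) := HasSubst.of_constantCoeff_zero'
    (by rw [map_mul, constantCoeff_logOf hf, mul_zero])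
  rw [formalPow, derivative_subst hs, derivative_exp, Derivation.leibniz, derivative_C]
  simp only [smul_eq_mul, mul_zero, add_zero]
  ring

/-- A solution of `f' = a · (log g)' · f` is a formal power of `g`. -/
theorem eq_formalPow {A : Type*} [CommRing A] [IsDomain A] [CharZero A] [Algebra ℚ A]
    {f g u : PowerSeries A} {a : A} (hf : derivative A f = C a * u * f)
    (hg : derivative A g = u * g) (hf0 : constantCoeff f = 1) (hg0 : constantCoeff g = 1) :
    f = formalPow g a := by
  have hu : derivative A (logOf g) = u := by
    have h := derivative_logOf_mul hg0
    rw [hg] at h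
    exact mul_right_cancel₀ (fun h0 => by simp [h0] at hg0) h
  refine eq_of_derivative_eq_mul hf ?_ (hf0.trans (constantCoeff_formalPow hg0 a).symm)
  rw [derivative_formalPow hg0, hu]

end FormalPow

/-! ### Relative orders of blocks, ascents and runs -/

section Words

open Equiv

/-- The permutation with the same relative order as an injective word. -/
noncomputable def std {p : ℕ} {α : Type*} [LinearOrder α] (w : Fin p → α) : Perm (Fin p) :=
  (Tuple.sort w)⁻¹

theorem std_lt_std_iff {p : ℕ} {α : Type*} [LinearOrder α] {w : Fin p → α}
    (hw : Function.Injective w) (a b : Fin p) : std w a < std w b ↔ w a < w b := by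
  have h : StrictMono (w ∘ Tuple.sort w) :=
    (Tuple.monotone_sort w).strictMono_of_injective (hw.comp (Tuple.sort w).injective)
  rw [← h.lt_iff_lt]
  simp [std]

theorem std_comp {p : ℕ} {α : Type*} [LinearOrder α] {w : Fin p → α}
    (hw : Function.Injective w) (π : Perm (Fin p)) : std (w ∘ π) = std w * π := by
  have h := (Tuple.comp_perm_comp_sort_eq_comp_sort (f := w) (σ := π))
  have h2 : (π * Tuple.sort (w ∘ π)) = Tuple.sort w := by
    ext a
    exact congrArg Fin.val (hw (congrFun h a))
  rw [std, std, ← h2]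
  group

/-- The positions `s, …, s + p - 1` among `0, …, n - 1`. -/
def seg (s : ℕ) {p n : ℕ} (h : s + p ≤ n) : Fin p ↪ Fin n where
  toFun a := ⟨s + a, by omega⟩
  inj' a b hab := by simpa [Fin.ext_iff] using hab

@[simp]
theorem seg_val (s : ℕ) {p n : ℕ} (h : s + p ≤ n) (a : Fin p) : (seg s h a : ℕ) = s + a := rfl

theorem mem_range_seg {s p n : ℕ} (h : s + p ≤ n) (i : Fin n) :
    i ∈ Set.range (seg s h) ↔ s ≤ i ∧ (i : ℕ) < s + p := by
  constructor
  · rintro ⟨a, rfl⟩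
    have := a.isLt
    simp
  · rintro ⟨h1, h2⟩
    exact ⟨⟨i - s, by omega⟩, by ext; simp; omega⟩

/-- Permuting the letters that occupy the range of `ι` leaves `G` unchanged and acts on the relative
order by right translation. Hence that order is uniformly distributed and independent of `G`. -/
theorem sum_std_mul {R : Type*} [CommRing R] {p n : ℕ} (ι : Fin p ↪ Fin n)
    (F : Perm (Fin p) → R) (G : Perm (Fin n) → R)
    (hG : ∀ (σ τ : Perm (Fin n)), (∀ i, i ∉ Set.range ι → σ i = τ i) → G σ = G τ) :
    (p.factorial : R) * ∑ σ : Perm (Fin n), F (std (σ ∘ ι)) * G σ =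
      (∑ π, F π) * ∑ σ, G σ := by
  have key : ∀ π : Perm (Fin p), ∑ σ : Perm (Fin n), F (std (σ ∘ ι)) * G σ =
      ∑ σ : Perm (Fin n), F (std (σ ∘ ι) * π) * G σ := by
    intro π
    -- Reindex by `σ * π'`, where `π'` acts as `π` on the range of `ι` and fixes all other
    -- positions.
    rw [← Equiv.sum_comp (Equiv.mulRight (π.viaFintypeEmbedding ι))]
    refine Finset.sum_congr rfl fun σ _ => ?_
    rw [← std_comp (σ.injective.comp ι.injective)]
    congr 1
    · congr 2
      ext a
      simp [Perm.viaFintypeEmbedding_apply_image]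
    · refine hG _ _ fun i hi => ?_
      simp [Perm.viaFintypeEmbedding_apply_notMem_range _ _ hi]
  calc (p.factorial : R) * ∑ σ : Perm (Fin n), F (std (σ ∘ ι)) * G σ
      = ∑ _π : Perm (Fin p), ∑ σ : Perm (Fin n), F (std (σ ∘ ι)) * G σ := by
        simp [Fintype.card_perm]
    _ = ∑ π : Perm (Fin p), ∑ σ : Perm (Fin n), F (std (σ ∘ ι) * π) * G σ :=
        Finset.sum_congr rfl fun π _ => key π
    _ = ∑ σ : Perm (Fin n), (∑ π, F π) * G σ := by
        rw [Finset.sum_comm]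
        refine Finset.sum_congr rfl fun σ _ => ?_
        rw [← Finset.sum_mul, ← Equiv.sum_comp (Equiv.mulLeft (std (σ ∘ ι))) F]
        rfl
    _ = _ := by rw [Finset.mul_sum]

/-- Summing over all permutations, the relative orders of the letters in two disjoint blocks of
positions, and a quantity depending only on the letters outside of both blocks, separate. -/
theorem sum_std_mul_std_mul {R : Type*} [CommRing R] {s p s' q n : ℕ} (h : s + p ≤ n)
    (h' : s' + q ≤ n) (hd : s + p ≤ s') (F : Perm (Fin p) → R) (G : Perm (Fin q) → R)
    (T : Perm (Fin n) → R)
    (hT : ∀ σ τ : Perm (Fin n), (∀ i : Fin n, s + p ≤ i → (i : ℕ) < s' → σ i = τ i) → T σ = T τ) :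
    (p.factorial : R) * q.factorial *
        ∑ σ : Perm (Fin n), F (std (σ ∘ seg s h)) * (G (std (σ ∘ seg s' h')) * T σ) =
      (∑ π, F π) * (∑ π, G π) * ∑ σ, T σ := by
  have h1 := sum_std_mul (seg s h) F (fun σ => G (std (σ ∘ seg s' h')) * T σ) (by
    intro σ τ hστ
    congr 1
    · congr 2
      ext a
      simp only [Function.comp_apply]
      rw [hστ]
      rw [mem_range_seg]
      simp
      omega
    · refine hT _ _ fun i hi hi' => hστ i ?_
      rw [mem_range_seg]
      omega)
  have h2 := sum_std_mul (seg s' h') G T (by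
    intro σ τ hστ
    refine hT _ _ fun i hi hi' => hστ i ?_
    rw [mem_range_seg]
    omega)
  linear_combination (q.factorial : R) * h1 + (∑ π, F π) * h2

/-- There is an ascent at position `i`. -/
def asc {n : ℕ} (σ : Perm (Fin n)) (i : ℕ) : Prop :=
  ∃ h : i + 1 < n, σ ⟨i, by omega⟩ < σ ⟨i + 1, h⟩

theorem asc_std_seg {s p n : ℕ} (h : s + p ≤ n) (σ : Perm (Fin n)) {i : ℕ} (hi : i + 1 < p) :
    asc (std (σ ∘ seg s h)) i ↔ asc σ (s + i) := by
  simp only [asc, std_lt_std_iff (σ.injective.comp (seg s h).injective)]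
  exact ⟨fun ⟨_, h2⟩ => ⟨by omega, h2⟩, fun ⟨_, h2⟩ => ⟨hi, h2⟩⟩

/-- Among the positions `0, …, n - 1` with ascents at the positions in `A`, there are `k`
consecutive ones with ascents between them. -/
def HasRun (k n : ℕ) (A : ℕ → Prop) : Prop :=
  ∃ s, s + k ≤ n ∧ ∀ i, s ≤ i → i + 1 < s + k → A i

theorem hasRun_congr {k n : ℕ} {A B : ℕ → Prop} (h : ∀ i, i + 1 < n → (A i ↔ B i)) :
    HasRun k n A ↔ HasRun k n B := by
  refine exists_congr fun s => and_congr_right fun hs => forall_congr' fun i =>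
    forall_congr' fun _ => forall_congr' fun _ => h i (by omega)

theorem strictMono_iff_forall_lt_succ {j : ℕ} {α : Type*} [Preorder α] (w : Fin j → α) :
    StrictMono w ↔ ∀ i (h : i + 1 < j), w ⟨i, by omega⟩ < w ⟨i + 1, h⟩ := by
  cases j with
  | zero => exact ⟨fun _ i h => by omega, fun _ a => a.elim0⟩
  | succ j =>
    rw [Fin.strictMono_iff_lt_succ]
    exact ⟨fun h i hi => h ⟨i, by omega⟩, fun h i => h i (by omega)⟩

theorem red_eq_iff_strictMono {j n : ℕ} (w : Fin j → Fin n) :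
    (∀ a, red w a = a) ↔ StrictMono w := by
  constructor
  · intro h a b hab
    by_contra hba
    have : red w b ≤ red w a := Finset.card_le_card fun c hc => by
      simp only [Finset.mem_filter, Finset.mem_univ, true_and] at hc ⊢
      exact hc.trans_le (not_lt.1 hba)
    rw [h, h] at this
    exact absurd hab (not_lt.2 this)
  · intro h a
    simp [red, h.lt_iff_lt, Finset.filter_gt_eq_Iio]

theorem hasMatch_one_iff {k n : ℕ} (σ : Perm (Fin n)) :
    HasMatch (1 : Perm (Fin k)) σ ↔ HasRun k n (asc σ) := by
  refine exists_congr fun s => ?_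
  simp only [Perm.one_apply, red_eq_iff_strictMono, strictMono_iff_forall_lt_succ]
  constructor
  · rintro ⟨h, h2⟩
    refine ⟨h, fun i hi hi' => ⟨by omega, ?_⟩⟩
    have := h2 (i - s) (by omega)
    simpa [show s + (i - s) = i by omega, show s + (i - s + 1) = i + 1 by omega] using this
  · rintro ⟨h, h2⟩
    exact ⟨h, fun i hi => (h2 (s + i) (by omega) (by omega)).2⟩

end Words

/-! ### Decomposition at the smallest letter -/

section Minimum

open Equiv

/-- A run straddling the cut would need an ascent at `p - 1`; here `2 ≤ k` excludes one-letter runs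
and the empty run. -/
theorem hasRun_append_iff {k p q n : ℕ} (hk : 2 ≤ k) (hn : n = p + q)
    {A : ℕ → Prop} (hA : ∀ i, i + 1 = p → ¬ A i) :
    HasRun k n A ↔ HasRun k p A ∨ HasRun k q (fun i => A (p + i)) := by
  constructor
  · rintro ⟨s, hs, h⟩
    by_cases hp : s + k ≤ p
    · exact Or.inl ⟨s, hp, h⟩
    · by_cases hsp : p ≤ s
      · exact Or.inr ⟨s - p, by omega, fun i hi hi' => h _ (by omega) (by omega)⟩
      · exact absurd (h (p - 1) (by omega) (by omega)) (hA _ (by omega))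
  · rintro (⟨s, hs, h⟩ | ⟨s, hs, h⟩)
    · exact ⟨s, by omega, h⟩
    · refine ⟨p + s, by omega, fun i hi hi' => ?_⟩
      simpa [show p + (i - p) = i by omega] using h (i - p) (by omega) (by omega)

/-- The ascents of a word after a new smallest letter has been put in front of it. -/
def consAsc (A : ℕ → Prop) : ℕ → Prop
  | 0 => True
  | i + 1 => A i

theorem hasRun_asc_iff_of_apply_eq_zero {k p q n : ℕ} (hk : 2 ≤ k) (h : p + q = n)
    (σ : Perm (Fin (n + 1))) (hσ : σ ⟨p, by omega⟩ = 0) :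
    HasRun k (n + 1) (asc σ) ↔
      HasRun k p (asc (std (σ ∘ seg 0 (p := p) (by omega)))) ∨
      HasRun k (q + 1) (consAsc (asc (std (σ ∘ seg (p + 1) (p := q) (by omega))))) := by
  rw [hasRun_append_iff (p := p) (q := q + 1) hk (by omega)]
  · refine or_congr (hasRun_congr fun i hi => ?_) (hasRun_congr fun i hi => ?_)
    · rw [asc_std_seg _ _ hi, zero_add]
    · cases i with
      | zero =>
        simp only [consAsc, iff_true]
        refine ⟨by omega, ?_⟩
        simp only [add_zero, hσ]
        refine Fin.pos_iff_ne_zero.2 fun h0 => ?_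
        have := congrArg Fin.val (σ.injective (h0.trans hσ.symm))
        simp at this
      | succ i =>
        rw [consAsc, asc_std_seg _ _ (by omega), show p + (i + 1) = p + 1 + i by omega]
  · rintro i rfl ⟨h1, h2⟩
    rw [hσ] at h2
    exact absurd h2 (Fin.not_lt_zero _)

/-- The smallest letter is itself a left-to-right minimum and rules out every later one. -/
theorem lrMin_of_apply_eq_zero {p n : ℕ} (h : p ≤ n)
    (σ : Perm (Fin (n + 1))) (hσ : σ ⟨p, by omega⟩ = 0) :
    lrMin σ = lrMin (std (σ ∘ seg 0 (p := p) (by omega))) + 1 := by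
  have hs : 0 + p ≤ n + 1 := by omega
  have hset : (Finset.univ.filter fun b : Fin (n + 1) => ∀ a, a < b → σ b < σ a) =
      insert ⟨p, by omega⟩ ((Finset.univ.filter fun b : Fin p =>
        ∀ a, a < b → std (σ ∘ seg 0 hs) b < std (σ ∘ seg 0 hs) a).map (seg 0 hs)) := by
    ext b
    simp only [Finset.mem_filter, Finset.mem_univ, true_and, Finset.mem_insert, Finset.mem_map,
      std_lt_std_iff (σ.injective.comp (seg 0 hs).injective), Function.comp_apply]
    constructor
    · intro hb
      by_cases hbp : (b : ℕ) < p
      · refine Or.inr ⟨⟨b, hbp⟩, fun a ha => ?_, by ext; simp⟩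
        have h1 : seg 0 hs ⟨b, hbp⟩ = b := by ext; simp
        rw [h1]
        refine hb _ ?_
        rw [Fin.lt_def] at ha ⊢
        simpa using ha
      · refine Or.inl ?_
        by_contra hne
        have h1 : (⟨p, by omega⟩ : Fin (n + 1)) < b := by
          rw [Fin.lt_def]
          rw [Fin.ext_iff] at hne
          simp only at hne ⊢
          omega
        have h2 := hb _ h1
        rw [hσ] at h2
        exact absurd h2 (Fin.not_lt_zero _)
    · rintro (rfl | ⟨b, hb, rfl⟩) a ha
      · rw [hσ]
        refine Fin.pos_iff_ne_zero.2 fun h0 => ?_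
        exact absurd (σ.injective (h0.trans hσ.symm)) ha.ne
      · rw [Fin.lt_def] at ha
        simp only [seg_val, zero_add] at ha
        have h1 : seg 0 hs ⟨a, by omega⟩ = a := by ext; simp
        rw [← h1]
        exact hb _ ha
  rw [lrMin, lrMin, hset, Finset.card_insert_of_notMem, Finset.card_map]
  simp only [Finset.mem_map, not_exists, not_and]
  intro x _ hx
  have := congrArg Fin.val hx
  simp at this
  omega

theorem sum_ite_symm_zero_eq {R : Type*} [CommRing R] {p n : ℕ} (h : p ≤ n) :
    ∑ σ : Perm (Fin (n + 1)), (if (σ.symm 0 : ℕ) = p then (1 : R) else 0) = n.factorial := by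
  rw [← Equiv.sum_comp (Equiv.inv (Perm (Fin (n + 1)))), ← Equiv.sum_comp Perm.decomposeFin.symm,
    Fintype.sum_prod_type]
  have h1 : ∀ (a : Fin (n + 1)) (e : Perm (Fin n)),
      (if (((Equiv.inv (Perm (Fin (n + 1)))) (Perm.decomposeFin.symm (a, e))).symm 0 : ℕ) = p
        then (1 : R) else 0) = if a = ⟨p, by omega⟩ then 1 else 0 := by
    intro a e
    have : ((Equiv.inv (Perm (Fin (n + 1)))) (Perm.decomposeFin.symm (a, e))).symm 0 = a :=
      Perm.decomposeFin_symm_apply_zero a e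
    rw [this]
    simp [Fin.ext_iff]
  simp only [h1]
  rw [Finset.sum_comm]
  simp [Fintype.card_perm]

open Classical in
/-- The weight of a permutation in `NM`. -/
noncomputable def weight (k : ℕ) {n : ℕ} (σ : Perm (Fin n)) : Polynomial ℚ :=
  if HasRun k n (asc σ) then 0 else Polynomial.X ^ lrMin σ

open Classical in
/-- The indicator of the permutations without a run of length `k` after a new smallest letter has
been put in front of them. -/
noncomputable def consIndicator (k : ℕ) {n : ℕ} (σ : Perm (Fin n)) : ℚ :=
  if HasRun k (n + 1) (consAsc (asc σ)) then 0 else 1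

/-- The exponential generating function of `consIndicator`. -/
noncomputable def consSeries (k : ℕ) : PowerSeries ℚ :=
  PowerSeries.mk fun n => (1 / n.factorial : ℚ) * ∑ σ : Perm (Fin n), consIndicator k σ

theorem coeff_NM_one (k n : ℕ) : PowerSeries.coeff n (NM (1 : Perm (Fin k))) =
    Polynomial.C (1 / (n.factorial : ℚ)) * ∑ σ : Perm (Fin n), weight k σ := by
  classical
  rw [NM, PowerSeries.coeff_mk, noMatch, Finset.sum_filter]
  congr 1
  refine Finset.sum_congr rfl fun σ _ => ?_
  by_cases h : HasRun k n (asc σ) <;> simp [weight, hasMatch_one_iff, h]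

theorem weight_mul_ite {k p q n : ℕ} (hk : 2 ≤ k) (h : p + q = n) (σ : Perm (Fin (n + 1))) :
    (if (σ.symm 0 : ℕ) = p then weight k σ else 0) =
      Polynomial.X * (weight k (std (σ ∘ seg 0 (p := p) (by omega))) *
        (Polynomial.C (consIndicator k (std (σ ∘ seg (p + 1) (p := q) (by omega)))) *
          if (σ.symm 0 : ℕ) = p then 1 else 0)) := by
  split_ifs with hp
  · have hσ : σ ⟨p, by omega⟩ = 0 := by
      rw [← Equiv.eq_symm_apply]
      exact Fin.ext hp.symm
    rw [weight, weight, consIndicator, hasRun_asc_iff_of_apply_eq_zero hk h σ hσ,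
      lrMin_of_apply_eq_zero (by omega) σ hσ]
    by_cases h1 : HasRun k p (asc (std (σ ∘ seg 0 (p := p) (by omega)))) <;>
    by_cases h2 : HasRun k (q + 1) (consAsc (asc (std (σ ∘ seg (p + 1) (p := q) (by omega))))) <;>
    simp [h1, h2, pow_succ']
  · simp

/-- Independence of the two blocks around position `p`; the remaining factor, the indicator that the
minimum sits at `p`, depends only on the letter there and sums to `n!`. -/
theorem sum_weight_ite {k p q n : ℕ} (hk : 2 ≤ k) (h : p + q = n) :
    Polynomial.C (1 / (n.factorial : ℚ)) *
      ∑ σ : Perm (Fin (n + 1)), (if (σ.symm 0 : ℕ) = p then weight k σ else 0) =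
    Polynomial.X * (Polynomial.C (1 / (p.factorial : ℚ)) * ∑ σ : Perm (Fin p), weight k σ) *
      Polynomial.C (1 / (q.factorial : ℚ) * ∑ σ : Perm (Fin q), consIndicator k σ) := by
  have key := sum_std_mul_std_mul (R := Polynomial ℚ) (s := 0) (p := p) (s' := p + 1) (q := q)
    (n := n + 1) (by omega) (by omega) (by omega) (weight k)
    (fun π => Polynomial.C (consIndicator k π))
    (fun σ => if (σ.symm 0 : ℕ) = p then 1 else 0) (by
      intro σ τ hστ
      have h1 : ∀ ρ : Perm (Fin (n + 1)), (ρ.symm 0 : ℕ) = p ↔ ρ ⟨p, by omega⟩ = 0 := by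
        intro ρ
        rw [← Equiv.eq_symm_apply, Fin.ext_iff, eq_comm]
      simp only [h1]
      rw [hστ _ (by simp) (by simp)])
  rw [sum_ite_symm_zero_eq (by omega)] at key
  simp only [weight_mul_ite hk h]
  rw [← Finset.mul_sum]
  have hC : ∀ m : ℕ, Polynomial.C (1 / (m.factorial : ℚ)) * (m.factorial : Polynomial ℚ) = 1 := by
    intro m
    rw [← Polynomial.C_eq_natCast, ← Polynomial.C_mul, one_div_mul_cancel, Polynomial.C_1]
    exact_mod_cast m.factorial_ne_zero
  have hp := hC p
  have hq := hC q
  have hn := hC n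
  rw [Polynomial.C_mul, map_sum]
  generalize Polynomial.C (1 / (p.factorial : ℚ)) = a at *
  generalize Polynomial.C (1 / (q.factorial : ℚ)) = b at *
  generalize Polynomial.C (1 / (n.factorial : ℚ)) = c at *
  generalize ∑ σ : Perm (Fin p), weight k σ = W at *
  generalize ∑ σ : Perm (Fin q), Polynomial.C (consIndicator k σ) = V at *
  generalize (∑ σ : Perm (Fin (n + 1)), _ : Polynomial ℚ) = S at *
  generalize (p.factorial : Polynomial ℚ) = p' at *
  generalize (q.factorial : Polynomial ℚ) = q' at *
  generalize (n.factorial : Polynomial ℚ) = n' at *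
  have h1 : S = a * b * (W * V * n') := by
    linear_combination a * b * key - (b * q') * S * hp - S * hq
  linear_combination c * Polynomial.X * h1 + a * b * Polynomial.X * W * V * hn

theorem derivative_NM {k : ℕ} (hk : 2 ≤ k) :
    PowerSeries.derivative _ (NM (1 : Perm (Fin k))) =
      PowerSeries.C Polynomial.X * PowerSeries.map Polynomial.C (consSeries k) *
        NM (1 : Perm (Fin k)) := by
  ext1 n
  rw [PowerSeries.coeff_derivative, coeff_NM_one, mul_assoc (PowerSeries.C _),
    PowerSeries.coeff_C_mul, mul_comm (PowerSeries.map _ _),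
    PowerSeries.coeff_mul]
  have h1 : ∀ x ∈ Finset.HasAntidiagonal.antidiagonal n,
      Polynomial.X * (PowerSeries.coeff x.1 (NM (1 : Perm (Fin k))) *
        PowerSeries.coeff x.2 (PowerSeries.map Polynomial.C (consSeries k))) =
      Polynomial.C (1 / (n.factorial : ℚ)) *
      ∑ σ : Perm (Fin (n + 1)), (if (σ.symm 0 : ℕ) = x.1 then weight k σ else 0) := by
    intro x hx
    rw [sum_weight_ite hk (Finset.HasAntidiagonal.mem_antidiagonal.1 hx), coeff_NM_one,
      PowerSeries.coeff_map,
      consSeries, PowerSeries.coeff_mk]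
    ring
  rw [Finset.mul_sum (Finset.HasAntidiagonal.antidiagonal n), Finset.sum_congr rfl h1, ← Finset.mul_sum, Finset.sum_comm]
  have h2 : ∀ σ : Perm (Fin (n + 1)), ∑ x ∈ Finset.HasAntidiagonal.antidiagonal n,
      (if (σ.symm 0 : ℕ) = x.1 then weight k σ else 0) = weight k σ := by
    intro σ
    -- The minimum sits at exactly one position, so a single term survives.
    rw [Finset.Nat.sum_antidiagonal_eq_sum_range_succ_mk, Finset.sum_ite_eq, if_pos]
    simpa using (σ.symm 0).isLt
  simp only [h2]
  rw [mul_right_comm]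
  congr 1
  rw [← Nat.cast_succ, ← Polynomial.C_eq_natCast, ← Polynomial.C_mul]
  congr 1
  rw [Nat.factorial_succ]
  push_cast
  field_simp

end Minimum

/-! ### The reciprocal of the denominator by signed cuts -/

section Runs

open Equiv

open Classical in
theorem sum_ite_forall_asc (m : ℕ) :
    ∑ σ : Perm (Fin m), (if ∀ i, i + 1 < m → asc σ i then (1 : ℚ) else 0) = 1 := by
  have h : ∀ σ : Perm (Fin m), (∀ i, i + 1 < m → asc σ i) ↔ σ = 1 := by
    intro σ
    have h1 : (∀ i, i + 1 < m → asc σ i) ↔ StrictMono σ := by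
      rw [strictMono_iff_forall_lt_succ]
      exact ⟨fun h i hi => (h i hi).2, fun h i hi => ⟨hi, h i hi⟩⟩
    rw [h1]
    constructor
    · intro hs
      exact (Perm.monotone_iff σ).1 hs.monotone
    · rintro rfl
      exact strictMono_id
  simp [h]

/-- Signed multiplicity of `m` in the exponents `k i` and `k i + 1`. -/
def runSign (k m : ℕ) : ℚ := (if m % k = 0 then 1 else 0) - (if m % k = 1 then 1 else 0)

theorem coeff_denom {k : ℕ} (hk : 2 ≤ k) (n : ℕ) :
    PowerSeries.coeff n (denom k) = 1 / (n.factorial : ℚ) * runSign k n := by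
  have h1 : ∀ i, PowerSeries.coeff n (summand k i) =
      (if n % k = 0 then if n / k = i then 1 / (n.factorial : ℚ) else 0 else 0) -
      (if n % k = 1 then if n / k = i then 1 / (n.factorial : ℚ) else 0 else 0) := by
    intro i
    have h0 : n = k * i ↔ n % k = 0 ∧ n / k = i := by
      constructor
      · rintro rfl
        exact ⟨Nat.mul_mod_right k i, Nat.mul_div_cancel_left i (by omega)⟩
      · rintro ⟨h, rfl⟩
        have := Nat.div_add_mod n k
        omega
    have h2 : n = k * i + 1 ↔ n % k = 1 ∧ n / k = i := by
      constructor
      · rintro rfl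
        refine ⟨?_, ?_⟩
        · rw [Nat.mul_add_mod, Nat.mod_eq_of_lt (by omega)]
        · rw [Nat.mul_add_div (by omega), Nat.div_eq_of_lt (by omega), add_zero]
      · rintro ⟨h, rfl⟩
        have := Nat.div_add_mod n k
        omega
    rw [summand, map_sub, PowerSeries.coeff_monomial, PowerSeries.coeff_monomial]
    congr 1
    · rw [← ite_and]
      by_cases h : n = k * i
      · rw [if_pos h, if_pos (h0.1 h), ← h]
      · rw [if_neg h, if_neg (h0.not.1 h)]
    · rw [← ite_and]
      by_cases h : n = k * i + 1
      · rw [if_pos h, if_pos (h2.1 h), ← h]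
      · rw [if_neg h, if_neg (h2.not.1 h)]
  have h3 : n / k < n + 1 := Nat.lt_succ_of_le (Nat.div_le_self n k)
  rw [denom, PowerSeries.coeff_mk]
  simp only [h1]
  rw [Finset.sum_sub_distrib, runSign]
  by_cases ha : n % k = 0 <;> by_cases hb : n % k = 1 <;> simp [ha, hb, h3]

/-- The admissible `m` are the last `k` integers up to `r`, truncated at `0`. They contain exactly
one multiple of `k` and, since `1 ≤ r`, exactly one number congruent to `1`. -/
theorem sum_runSign_eq_zero {k r n : ℕ} (hk : 2 ≤ k) (hr : 1 ≤ r) (hrn : r ≤ n) :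
    ∑ m ∈ Finset.range (n + 1), (if m ≤ r ∧ r < m + k then runSign k m else 0) = 0 := by
  have key : ∀ c d : ℕ, (∀ m, (m ≤ r ∧ r < m + k) ∧ m % k = c ↔ m = d) → d ≤ r →
      ∑ m ∈ Finset.range (n + 1),
        (if m ≤ r ∧ r < m + k then if m % k = c then (1 : ℚ) else 0 else 0) = 1 := by
    intro c d h hd
    simp only [← ite_and, h]
    rw [Finset.sum_ite_eq', if_pos (by simp; omega)]
  have hmod : ∀ m e, m ≤ e → e < m + k → m % k = 0 → m = e - e % k := by
    intro m e h1 h2 h3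
    obtain ⟨j, rfl⟩ := Nat.dvd_of_mod_eq_zero h3
    obtain ⟨t, rfl⟩ := Nat.exists_eq_add_of_le h1
    rw [Nat.mul_add_mod, Nat.mod_eq_of_lt (by omega)]
    omega
  have h0 := key 0 (r - r % k) (fun m => ⟨fun h => hmod m r h.1.1 h.1.2 h.2, by
    rintro rfl
    have := Nat.mod_lt r (show k > 0 by omega)
    have := Nat.mod_le r k
    refine ⟨by omega, Nat.mod_eq_zero_of_dvd (Nat.dvd_sub_mod r)⟩⟩) (by omega)
  -- The largest number up to `r` congruent to `1` is one more than the largest multiple of `k` up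
  -- to `r - 1`.
  have h1 := key 1 (r - 1 - (r - 1) % k + 1) (fun m => ⟨fun h => by
      have hm : 1 ≤ m := by
        rcases Nat.eq_zero_or_pos m with rfl | h0
        · simp at h
        · exact h0
      obtain ⟨m, rfl⟩ := Nat.exists_eq_add_of_le' hm
      have h3 : m % k = 0 := by
        have h2 := h.2
        have h4 : (m + 1) ≡ 0 + 1 [MOD k] := by
          rw [Nat.ModEq, h2, Nat.mod_eq_of_lt (by omega)]
        have h5 := Nat.ModEq.add_right_cancel' 1 h4
        rw [Nat.ModEq] at h5
        simpa using h5
      rw [← hmod m (r - 1) (by omega) (by omega) h3], by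
    rintro rfl
    have := Nat.mod_lt (r - 1) (show k > 0 by omega)
    have := Nat.mod_le (r - 1) k
    refine ⟨by omega, ?_⟩
    rw [Nat.add_mod, Nat.mod_eq_zero_of_dvd (Nat.dvd_sub_mod (r - 1)), zero_add, Nat.mod_mod,
      Nat.mod_eq_of_lt (by omega)]⟩) (by
    have := Nat.mod_le (r - 1) k
    omega)
  have h2 : ∀ m, (if m ≤ r ∧ r < m + k then runSign k m else 0) =
      (if m ≤ r ∧ r < m + k then if m % k = 0 then (1 : ℚ) else 0 else 0) -
      (if m ≤ r ∧ r < m + k then if m % k = 1 then (1 : ℚ) else 0 else 0) := by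
    intro m
    by_cases h : m ≤ r ∧ r < m + k
    · simp only [if_pos h, runSign]
    · simp only [if_neg h, sub_self]
  simp only [h2]
  rw [Finset.sum_sub_distrib, h0, h1, sub_self]

open Classical in
/-- The signed count of the ways to cut a word, with ascents at the positions in `A`, into a word
without a run of length `k` followed by an increasing word, vanishes. -/
theorem sum_cut_eq_zero {k n : ℕ} (hk : 2 ≤ k) (hn : 1 ≤ n) (A : ℕ → Prop) :
    ∑ m ∈ Finset.range (n + 1),
      (if ¬ HasRun k (n - m) A ∧ ∀ i, n - m ≤ i → i + 1 < n → A i then runSign k m else 0) = 0 := by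
  let Q : ℕ → Prop := fun r => ∀ i, n - r ≤ i → i + 1 < n → A i
  -- The length of the longest increasing suffix; it is at least `1` because a single letter is
  -- increasing.
  let r := Nat.findGreatest Q n
  have hQr : Q r := Nat.findGreatest_spec (P := Q) hn (fun i _ _ => by omega)
  have hr1 : 1 ≤ r := Nat.le_findGreatest hn (fun i _ _ => by omega)
  have hrn : r ≤ n := Nat.findGreatest_le n
  have hQ : ∀ m, m ≤ n → (Q m ↔ m ≤ r) := by
    intro m hm
    exact ⟨fun h => Nat.le_findGreatest hm h, fun h i hi hi' => hQr i (by omega) hi'⟩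
  have hdesc : r < n → ¬ A (n - r - 1) := by
    intro hlt hA
    have : Q (r + 1) := by
      intro i hi hi'
      rcases eq_or_ne i (n - r - 1) with rfl | hne
      · exact hA
      · exact hQr i (by omega) hi'
    have := (hQ (r + 1) (by omega)).1 this
    omega
  -- No run crosses the descent before the longest increasing suffix, so a run in the prefix lies
  -- before it or within the `r - m` letters left of the suffix.
  have hcut : ∀ m, m ≤ r → (¬ HasRun k (n - m) A ↔ ¬ HasRun k (n - r) A ∧ r < m + k) := by
    intro m hm
    constructor
    · intro h
      refine ⟨fun ⟨s, hs, hs'⟩ => h ⟨s, by omega, hs'⟩, ?_⟩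
      by_contra hlt
      exact h ⟨n - r, by omega, fun i hi hi' => hQr i hi (by omega)⟩
    · rintro ⟨h, hlt⟩ ⟨s, hs, hs'⟩
      by_cases hsr : s + k ≤ n - r
      · exact h ⟨s, hsr, hs'⟩
      · exact hdesc (by omega) (hs' _ (by omega) (by omega))
  by_cases hE : HasRun k (n - r) A
  · refine Finset.sum_eq_zero fun m hm => if_neg ?_
    rintro ⟨h1, h2⟩
    exact ((hcut m ((hQ m (by simp at hm; omega)).1 h2)).1 h1).1 hE
  · refine Eq.trans (Finset.sum_congr rfl fun m hm => ?_) (sum_runSign_eq_zero hk hr1 hrn)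
    have hmn : m ≤ n := by simp at hm; omega
    have : (¬ HasRun k (n - m) A ∧ Q m) ↔ m ≤ r ∧ r < m + k := by
      rw [hQ m hmn]
      constructor
      · rintro ⟨h1, h2⟩
        exact ⟨h2, ((hcut m h2).1 h1).2⟩
      · rintro ⟨h1, h2⟩
        exact ⟨(hcut m h1).2 ⟨hE, h2⟩, h1⟩
    exact if_congr this rfl rfl

open Classical in
/-- The indicator of the permutations without a run of length `k`. -/
noncomputable def runFree (k : ℕ) {n : ℕ} (σ : Perm (Fin n)) : ℚ :=
  if HasRun k n (asc σ) then 0 else 1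

/-- The exponential generating function of the permutations without a run of length `k`. -/
noncomputable def runFreeSeries (k : ℕ) : PowerSeries ℚ :=
  PowerSeries.mk fun n => (1 / n.factorial : ℚ) * ∑ σ : Perm (Fin n), runFree k σ

-- Independence of the adjacent blocks of lengths `p` and `m`; only one relative order of the second
-- block is increasing.
open Classical in
theorem sum_runFree_cut {k p m n : ℕ} (h : p + m = n) :
    1 / (p.factorial : ℚ) * (∑ σ : Perm (Fin p), runFree k σ) * (1 / m.factorial) =
    1 / (n.factorial : ℚ) * ∑ σ : Perm (Fin n),
      if ¬ HasRun k (n - m) (asc σ) ∧ ∀ i, n - m ≤ i → i + 1 < n → asc σ i then 1 else 0 := by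
  have hp : (p.factorial : ℚ) ≠ 0 := by exact_mod_cast p.factorial_ne_zero
  have hm : (m.factorial : ℚ) ≠ 0 := by exact_mod_cast m.factorial_ne_zero
  have hn : (n.factorial : ℚ) ≠ 0 := by exact_mod_cast n.factorial_ne_zero
  have key := sum_std_mul_std_mul (R := ℚ) (s := 0) (p := p) (s' := p) (q := m)
    (n := n) (by omega) (by omega) (by omega) (runFree k)
    (fun π => if ∀ i, i + 1 < m → asc π i then (1 : ℚ) else 0)
    (fun _ => 1) (fun _ _ _ => rfl)
  rw [sum_ite_forall_asc] at key
  have h1 : ∀ σ : Perm (Fin n),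
      runFree k (std (σ ∘ seg 0 (p := p) (by omega))) *
        ((if ∀ i, i + 1 < m → asc (std (σ ∘ seg p (p := m) (by omega))) i then (1 : ℚ) else 0) * 1)
      = if ¬ HasRun k (n - m) (asc σ) ∧ ∀ i, n - m ≤ i → i + 1 < n → asc σ i then 1 else 0 := by
    intro σ
    have ha : HasRun k p (asc (std (σ ∘ seg 0 (p := p) (by omega)))) ↔
        HasRun k (n - m) (asc σ) := by
      rw [show n - m = p by omega]
      exact hasRun_congr fun i hi => by rw [asc_std_seg _ _ hi, zero_add]
    have hb : (∀ i, i + 1 < m → asc (std (σ ∘ seg p (p := m) (by omega))) i) ↔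
        ∀ i, n - m ≤ i → i + 1 < n → asc σ i := by
      constructor
      · intro h2 i hi hi'
        have := h2 (i - p) (by omega)
        rwa [asc_std_seg _ _ (by omega), show p + (i - p) = i by omega] at this
      · intro h2 i hi
        rw [asc_std_seg _ _ hi]
        exact h2 _ (by omega) (by omega)
    rw [runFree]
    simp only [ha, hb]
    by_cases h1 : HasRun k (n - m) (asc σ) <;> simp [h1]
  simp only [h1] at key
  simp only [Finset.sum_const, Finset.card_univ, Fintype.card_perm, Fintype.card_fin,
    nsmul_eq_mul, mul_one] at key
  field_simp
  linear_combination -key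

theorem runFreeSeries_mul_denom {k : ℕ} (hk : 2 ≤ k) : runFreeSeries k * denom k = 1 := by
  classical
  ext n
  rw [PowerSeries.coeff_mul]
  have h1 : ∀ x ∈ Finset.HasAntidiagonal.antidiagonal n,
      PowerSeries.coeff x.1 (runFreeSeries k) * PowerSeries.coeff x.2 (denom k) =
      1 / (n.factorial : ℚ) * ∑ σ : Perm (Fin n),
        if ¬ HasRun k (n - x.2) (asc σ) ∧ ∀ i, n - x.2 ≤ i → i + 1 < n → asc σ i
          then runSign k x.2 else 0 := by
    intro x hx
    rw [runFreeSeries, PowerSeries.coeff_mk, coeff_denom hk, ← mul_assoc,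
      sum_runFree_cut (Finset.HasAntidiagonal.mem_antidiagonal.1 hx), mul_assoc, Finset.sum_mul]
    simp only [ite_mul, one_mul, zero_mul]
  rw [Finset.sum_congr rfl h1, ← Finset.mul_sum, Finset.sum_comm]
  have h2 : ∀ σ : Perm (Fin n), (∑ x ∈ Finset.HasAntidiagonal.antidiagonal n,
        if ¬ HasRun k (n - x.2) (asc σ) ∧ ∀ i, n - x.2 ≤ i → i + 1 < n → asc σ i
          then runSign k x.2 else 0) = if n = 0 then 1 else 0 := by
    intro σ
    rw [← Finset.Nat.sum_antidiagonal_swap, Finset.Nat.sum_antidiagonal_eq_sum_range_succ_mk]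
    rcases Nat.eq_zero_or_pos n with rfl | hn
    · have : ¬ HasRun k 0 (asc σ) := fun ⟨s, hs, _⟩ => by omega
      rw [Nat.succ_eq_add_one, zero_add, Finset.sum_range_one]
      refine (if_pos ⟨this, fun i _ hi => by omega⟩).trans ?_
      simp [runSign]
    · rw [if_neg (by omega)]
      exact sum_cut_eq_zero hk hn (asc σ)
  simp only [h2, PowerSeries.coeff_one]
  split_ifs with hn
  · subst hn
    simp
  · simp

theorem map_evalRingHom_NM (k : ℕ) :
    PowerSeries.map (Polynomial.evalRingHom 1) (NM (1 : Perm (Fin k))) = runFreeSeries k := by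
  ext n
  rw [PowerSeries.coeff_map, coeff_NM_one, runFreeSeries, PowerSeries.coeff_mk, map_mul, map_sum]
  congr 1
  · simp
  · refine Finset.sum_congr rfl fun σ _ => ?_
    by_cases h : HasRun k n (asc σ) <;> simp [weight, runFree, h]

theorem derivative_map {A B : Type*} [CommSemiring A] [CommSemiring B] (φ : A →+* B)
    (f : PowerSeries A) : PowerSeries.derivative B (PowerSeries.map φ f) =
      PowerSeries.map φ (PowerSeries.derivative A f) := by
  ext n
  simp [PowerSeries.coeff_derivative]

/-- This is `derivative_NM` evaluated at `x = 1`. -/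
theorem derivative_runFreeSeries {k : ℕ} (hk : 2 ≤ k) :
    PowerSeries.derivative ℚ (runFreeSeries k) = consSeries k * runFreeSeries k := by
  rw [← map_evalRingHom_NM, derivative_map, derivative_NM hk, map_mul, map_mul]
  congr 1
  ext n
  simp

theorem constantCoeff_NM_one {k : ℕ} (hk : 2 ≤ k) :
    PowerSeries.constantCoeff (NM (1 : Perm (Fin k))) = 1 := by
  have h : ∀ A, ¬ HasRun k 0 A := fun A ⟨s, hs, _⟩ => by omega
  rw [← PowerSeries.coeff_zero_eq_constantCoeff_apply, coeff_NM_one]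
  simp [weight, lrMin, h]

end Runs

end PermMatch

theorem mainTheorem9 (k : ℕ) (hk : 2 ≤ k) :
    PermMatch.NM (1 : Equiv.Perm (Fin k)) =
      PermMatch.formalPow (PowerSeries.map Polynomial.C (PermMatch.denom k)⁻¹)
        (Polynomial.X : Polynomial ℚ) := by
  have hD : PowerSeries.constantCoeff (PermMatch.denom k) ≠ 0 := by
    rw [← PowerSeries.coeff_zero_eq_constantCoeff_apply, PermMatch.coeff_denom hk]
    simp [PermMatch.runSign]
  have hinv : (PermMatch.denom k)⁻¹ = PermMatch.runFreeSeries k :=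
    (PowerSeries.eq_inv_iff_mul_eq_one hD).2 (PermMatch.runFreeSeries_mul_denom hk) |>.symm
  rw [hinv]
  refine PermMatch.eq_formalPow (PermMatch.derivative_NM hk) ?_
    (PermMatch.constantCoeff_NM_one hk) ?_
  · rw [PermMatch.derivative_map, PermMatch.derivative_runFreeSeries hk, map_mul]
  · rw [← PermMatch.map_evalRingHom_NM, ← PowerSeries.coeff_zero_eq_constantCoeff_apply,
      PowerSeries.coeff_map, PowerSeries.coeff_map,
      PowerSeries.coeff_zero_eq_constantCoeff_apply, PermMatch.constantCoeff_NM_one hk]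
    simp
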